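/- A skew (left) brace is a set $B$ with two operations $+$ and $\cdot$ such that $(B,+)$ and $(B,\cdot)$ are groups (neither assumed commutative) and $x(y+z)=xy-x+xz$ for all $x,y,z\in B$; both groups have the same identity element $0$. Put $\lambda_a(b)=-a+ab$; then $\lambda$ is a homomorphism $(B,\cdot)\to\operatorname{Aut}(B,+)$. A subbrace of $B$ is a subset that is a subgroup of both $(B,+)$ and $(B,\cdot)$. An ideal of $B$ is a subbrace $I$ that is normal in $(B,+)$ and in $(B,\cdot)$ and satisfies $\lambda_b(I)\subseteq I$ for all $b\in B$; then $I$ is itself a skew brace, and the cosets $b+I=bI$ form the quotient skew brace $B/I$. Let $$\operatorname{Soc}(B)=\operatorname{Ker}\lambda\cap Z(B,+),\qquad \zeta(B)=\operatorname{Soc}(B)\cap Z(B,\cdot),$$ which are ideals of $B$. Define ideals $\zeta_n(B)$ by $\zeta_0(B)=\{0\}$ and $\zeta_{n+1}(B)/\zeta_n(B)=\zeta(B/\zeta_n(B))$. The skew brace $B$ is centrally nilpotent if $B=\zeta_m(B)$ for some integer $m\ge 0$. An ideal of $B$ is called centrally nilpotent if it is centrally nilpotent as a skew brace. An ideal $I$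 of $B$ is $B$-centrally nilpotent if there is a finite chain $\{0\}=I_0\le I_1\le\dots\le I_n=I$ of ideals of $B$ such that $I_{i+1}/I_i\le\zeta(I/I_i)$ for all $0\le i<n$. The sum of a family of ideals of $B$ is the subgroup of $(B,+)$ generated by their union, which is an ideal of $B$. The Fitting ideal $\operatorname{Fit}(B)$ is the sum of all $B$-centrally nilpotent ideals of $B$. The skew brace $B$ is supersoluble if there is a finite chain $\{0\}=I_0\le I_1\le\dots\le I_n=B$ of ideals of $B$ such that, for every $0\le i<n$, either $(I_{i+1}/I_i,+)$ is infinite cyclic and $I_{i+1}/I_i\le\operatorname{Soc}(B/I_i)$, or $I_{i+1}/I_i$ has prime order. **Theorem.** Let $B$ be a supersoluble skew brace. Then: 1. every centrally nilpotent ideal of $B$ is $B$-centrally nilpotent; 2. the Fitting ideal $\operatorname{Fit}(B)$ is centrally nilpotent; 3. $\operatorname{Fit}(B)$ is equal to the sum of all centrally nilpotent ideals of $B$. -/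

import Mathlib

/-- A skew (left) brace: two group structures on the same set, linked by the skew distributive law
`x (y + z) = x y - x + x z`. The additive group is not assumed to be commutative. -/
class SkewBrace (B : Type*) extends AddGroup B, Group B where
  mul_add_skew : ∀ x y z : B, x * (y + z) = x * y - x + x * z

namespace SkewBrace

variable {B : Type*} [SkewBrace B]

/-- The map `λ_a(b) = -a + ab`. -/
def lam (a b : B) : B := -a + a * b

theorem one_eq_zero : (1 : B) = 0 := by
  have h := mul_add_skew (1 : B) 0 0
  simp only [one_mul, add_zero, zero_sub] at h
  rw [eq_comm, neg_eq_zero] at h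
  exact h

theorem mul_zero' (a : B) : a * 0 = a := by rw [← one_eq_zero, mul_one]

theorem zero_mul' (a : B) : 0 * a = a := by rw [← one_eq_zero, one_mul]

theorem mul_eq (a b : B) : a * b = a + lam a b := by simp [lam]

theorem lam_add (a b c : B) : lam a (b + c) = lam a b + lam a c := by
  simp [lam, mul_add_skew, sub_eq_add_neg, add_assoc]

theorem lam_zero (a : B) : lam a 0 = 0 := by simp [lam, mul_zero']

theorem lam_neg (a b : B) : lam a (-b) = -lam a b := by
  apply eq_neg_of_add_eq_zero_left
  rw [← lam_add, neg_add_cancel, lam_zero]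

theorem lam_mul (a b c : B) : lam (a * b) c = lam a (lam b c) := by
  rw [show lam b c = -b + b * c from rfl, lam_add, lam_neg]
  simp [lam, mul_assoc]

theorem lam_one (a : B) : lam 1 a = a := by simp [lam, one_eq_zero, zero_mul']

theorem add_eq (a b : B) : a + b = a * lam a⁻¹ b := by
  rw [mul_eq, ← lam_mul, mul_inv_cancel, lam_one]

theorem neg_add_eq_lam (a b : B) : -a + b = lam a (a⁻¹ * b) := by simp [lam]

theorem inv_mul_eq_lam (a b : B) : a⁻¹ * b = lam a⁻¹ (-a + b) := by
  rw [neg_add_eq_lam, ← lam_mul, inv_mul_cancel, lam_one]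

theorem inv_eq (a : B) : a⁻¹ = -lam a⁻¹ a := by
  have h := inv_mul_eq_lam a 0
  rwa [mul_zero', add_zero, lam_neg] at h

end SkewBrace

/-- A subbrace: a subset that is a subgroup for both operations. -/
structure Subbrace (B : Type*) [SkewBrace B] extends AddSubgroup B, Subgroup B

namespace Subbrace

variable {B : Type*} [SkewBrace B]

instance : SetLike (Subbrace B) B where
  coe S := S.carrier
  coe_injective S T h := by
    obtain ⟨⟨⟨⟨_, _⟩, _⟩, _⟩, _, _, _⟩ := S
    obtain ⟨⟨⟨⟨_, _⟩, _⟩, _⟩, _, _, _⟩ := T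
    cases h
    rfl

instance (S : Subbrace B) : Zero S := ⟨⟨0, S.zero_mem'⟩⟩
instance (S : Subbrace B) : One S := ⟨⟨1, S.one_mem'⟩⟩
instance (S : Subbrace B) : Add S := ⟨fun a b => ⟨a + b, S.add_mem' a.2 b.2⟩⟩
instance (S : Subbrace B) : Mul S := ⟨fun a b => ⟨a * b, S.mul_mem' a.2 b.2⟩⟩
instance (S : Subbrace B) : Neg S := ⟨fun a => ⟨-a, S.neg_mem' a.2⟩⟩
instance (S : Subbrace B) : Inv S := ⟨fun a => ⟨(a : B)⁻¹, S.inv_mem' a.2⟩⟩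

/-- A subbrace is a skew brace with the restricted operations. -/
instance (S : Subbrace B) : SkewBrace S where
  toAddGroup := AddGroup.ofLeftAxioms
    (fun a b c => Subtype.ext (add_assoc (a : B) b c))
    (fun a => Subtype.ext (zero_add (a : B)))
    (fun a => Subtype.ext (neg_add_cancel (a : B)))
  toGroup := Group.ofLeftAxioms
    (fun a b c => Subtype.ext (mul_assoc (a : B) b c))
    (fun a => Subtype.ext (one_mul (a : B)))
    (fun a => Subtype.ext (inv_mul_cancel (a : B)))
  mul_add_skew a b c := Subtype.ext (by
    have h := SkewBrace.mul_add_skew (a : B) b c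
    rw [sub_eq_add_neg] at h
    exact h)

end Subbrace

open SkewBrace

/-- An ideal of a skew brace `B`: a subbrace that is `λ`-invariant and normal in both `(B,+)` and
`(B,·)`. -/
structure BraceIdeal (B : Type*) [SkewBrace B] extends Subbrace B where
  lam_mem' : ∀ (b : B) {x : B}, x ∈ carrier → lam b x ∈ carrier
  add_conj_mem' : ∀ (b : B) {x : B}, x ∈ carrier → b + x + -b ∈ carrier
  mul_conj_mem' : ∀ (b : B) {x : B}, x ∈ carrier → b * x * b⁻¹ ∈ carrier

namespace BraceIdeal

variable {B : Type*} [SkewBrace B]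

instance : SetLike (BraceIdeal B) B where
  coe S := S.carrier
  coe_injective S T h := by
    obtain ⟨S, _, _, _⟩ := S
    obtain ⟨T, _, _, _⟩ := T
    have : S = T := SetLike.coe_injective h
    cases this
    rfl

/-- Ideals are ordered by inclusion. -/
instance : PartialOrder (BraceIdeal B) := PartialOrder.ofSetLike (BraceIdeal B) B

theorem zero_mem (I : BraceIdeal B) : (0 : B) ∈ I := I.zero_mem'
theorem add_mem (I : BraceIdeal B) {x y : B} (hx : x ∈ I) (hy : y ∈ I) : x + y ∈ I :=
  I.add_mem' hx hy
theorem neg_mem (I : BraceIdeal B) {x : B} (hx : x ∈ I) : -x ∈ I := I.neg_mem' hx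
theorem mul_mem (I : BraceIdeal B) {x y : B} (hx : x ∈ I) (hy : y ∈ I) : x * y ∈ I :=
  I.mul_mem' hx hy
theorem inv_mem (I : BraceIdeal B) {x : B} (hx : x ∈ I) : x⁻¹ ∈ I := I.inv_mem' hx
theorem lam_mem (I : BraceIdeal B) (b : B) {x : B} (hx : x ∈ I) : lam b x ∈ I := I.lam_mem' b hx
theorem add_conj_mem (I : BraceIdeal B) (b : B) {x : B} (hx : x ∈ I) : b + x + -b ∈ I :=
  I.add_conj_mem' b hx
theorem mul_conj_mem (I : BraceIdeal B) (b : B) {x : B} (hx : x ∈ I) : b * x * b⁻¹ ∈ I :=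
  I.mul_conj_mem' b hx

/-- Constructor of ideals: a normal subgroup `S` of `(B,+)` that is `λ`-invariant and stable under
multiplicative conjugation is automatically a subgroup of `(B,·)`. -/
def ofAddSubgroup (S : AddSubgroup B) (h1 : ∀ (b : B) {x : B}, x ∈ S → lam b x ∈ S)
    (h2 : ∀ (b : B) {x : B}, x ∈ S → b + x + -b ∈ S)
    (h3 : ∀ (b : B) {x : B}, x ∈ S → b * x * b⁻¹ ∈ S) : BraceIdeal B where
  toAddSubgroup := S
  mul_mem' {a b} ha hb := by
    rw [mul_eq]
    exact S.add_mem ha (h1 a hb)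
  one_mem' := by
    rw [one_eq_zero]
    exact S.zero_mem
  inv_mem' {a} ha := by
    rw [inv_eq]
    exact S.neg_mem (h1 _ ha)
  lam_mem' b _ hx := h1 b hx
  add_conj_mem' b _ hx := h2 b hx
  mul_conj_mem' b _ hx := h3 b hx

/-- The zero ideal. -/
instance : Bot (BraceIdeal B) := ⟨ofAddSubgroup ⊥
  (by rintro b x hx; rw [AddSubgroup.mem_bot] at *; rw [hx, lam_zero])
  (by rintro b x hx; rw [AddSubgroup.mem_bot] at *; simp [hx])
  (by rintro b x hx; rw [AddSubgroup.mem_bot] at *; rw [hx, mul_zero', mul_inv_cancel, one_eq_zero])⟩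

/-- The ideal `B` of `B`. -/
instance : Top (BraceIdeal B) := ⟨ofAddSubgroup ⊤
  (fun _ _ _ => trivial) (fun _ _ _ => trivial) (fun _ _ _ => trivial)⟩

/-! ### Quotients -/

instance addNormal (I : BraceIdeal B) : I.toAddSubgroup.Normal :=
  ⟨fun _ hx b => I.add_conj_mem b hx⟩

theorem neg_add_mem_iff (I : BraceIdeal B) (a b : B) : -a + b ∈ I ↔ a⁻¹ * b ∈ I := by
  constructor
  · intro h
    rw [inv_mul_eq_lam]
    exact I.lam_mem _ h
  · intro h
    rw [neg_add_eq_lam]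
    exact I.lam_mem _ h

/-- The underlying set of the quotient brace `B/I`: the set of cosets `b + I = bI`. -/
def Quotient (I : BraceIdeal B) : Type _ := B ⧸ I.toAddSubgroup

/-- The projection `B → B/I`. -/
def proj (I : BraceIdeal B) (b : B) : I.Quotient := QuotientAddGroup.mk b

theorem proj_eq_proj (I : BraceIdeal B) {a b : B} : I.proj a = I.proj b ↔ -a + b ∈ I :=
  QuotientAddGroup.eq

theorem proj_surjective (I : BraceIdeal B) : Function.Surjective I.proj :=
  QuotientAddGroup.mk_surjective

instance (I : BraceIdeal B) : AddGroup I.Quotient :=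
  inferInstanceAs (AddGroup (B ⧸ I.toAddSubgroup))

theorem proj_add (I : BraceIdeal B) (a b : B) : I.proj (a + b) = I.proj a + I.proj b := rfl

theorem proj_neg (I : BraceIdeal B) (a : B) : I.proj (-a) = -I.proj a := rfl

theorem proj_zero (I : BraceIdeal B) : I.proj 0 = 0 := rfl

instance (I : BraceIdeal B) : Mul I.Quotient where
  mul := _root_.Quotient.map₂ (· * ·) (by
    intro a a' ha b b' hb
    have ha : a⁻¹ * a' ∈ I := (I.neg_add_mem_iff a a').1 (QuotientAddGroup.leftRel_apply.1 ha)
    have hb : b⁻¹ * b' ∈ I := (I.neg_add_mem_iff b b').1 (QuotientAddGroup.leftRel_apply.1 hb)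
    refine QuotientAddGroup.leftRel_apply.2 ((I.neg_add_mem_iff (a * b) (a' * b')).2 ?_)
    have h := I.mul_mem (I.mul_conj_mem b⁻¹ ha) hb
    have e : (a * b)⁻¹ * (a' * b') = b⁻¹ * (a⁻¹ * a') * b⁻¹⁻¹ * (b⁻¹ * b') := by group
    rw [e]
    exact h)

instance (I : BraceIdeal B) : One I.Quotient := ⟨I.proj 1⟩

instance (I : BraceIdeal B) : Inv I.Quotient where
  inv := _root_.Quotient.map (·⁻¹) (by
    intro a a' ha
    have ha : a⁻¹ * a' ∈ I := (I.neg_add_mem_iff a a').1 (QuotientAddGroup.leftRel_apply.1 ha)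
    refine QuotientAddGroup.leftRel_apply.2 ((I.neg_add_mem_iff a⁻¹ a'⁻¹).2 ?_)
    have h := I.inv_mem (I.mul_conj_mem a ha)
    have e : a⁻¹⁻¹ * a'⁻¹ = (a * (a⁻¹ * a') * a⁻¹)⁻¹ := by group
    rw [e]
    exact h)

theorem proj_mul (I : BraceIdeal B) (a b : B) : I.proj (a * b) = I.proj a * I.proj b := rfl

theorem proj_inv (I : BraceIdeal B) (a : B) : I.proj a⁻¹ = (I.proj a)⁻¹ := rfl

theorem proj_one (I : BraceIdeal B) : I.proj 1 = 1 := rfl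

/-- The quotient brace `B/I`, with the operations induced by those of `B`. -/
instance (I : BraceIdeal B) : SkewBrace I.Quotient where
  toGroup := Group.ofLeftAxioms
    (by
      intro a b c
      obtain ⟨a, rfl⟩ := I.proj_surjective a
      obtain ⟨b, rfl⟩ := I.proj_surjective b
      obtain ⟨c, rfl⟩ := I.proj_surjective c
      simp only [← proj_mul, mul_assoc])
    (by
      intro a
      obtain ⟨a, rfl⟩ := I.proj_surjective a
      simp only [← proj_mul, ← proj_one, one_mul])
    (by
      intro a
      obtain ⟨a, rfl⟩ := I.proj_surjective a
      simp only [← proj_mul, ← proj_one, ← proj_inv, inv_mul_cancel])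
  mul_add_skew a b c := by
    obtain ⟨a, rfl⟩ := I.proj_surjective a
    obtain ⟨b, rfl⟩ := I.proj_surjective b
    obtain ⟨c, rfl⟩ := I.proj_surjective c
    have h := congrArg I.proj (SkewBrace.mul_add_skew a b c)
    rw [sub_eq_add_neg] at h ⊢
    exact h

/-- The image `(J + I)/I` of an ideal `J` of `B` in `B/I`; it is `J/I` when `I ≤ J`. -/
def factor (J I : BraceIdeal B) : BraceIdeal I.Quotient :=
  ofAddSubgroup
    { carrier := I.proj '' (J : Set B)
      zero_mem' := ⟨0, J.zero_mem, rfl⟩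
      add_mem' := by
        rintro _ _ ⟨a, ha, rfl⟩ ⟨b, hb, rfl⟩
        exact ⟨a + b, J.add_mem ha hb, rfl⟩
      neg_mem' := by
        rintro _ ⟨a, ha, rfl⟩
        exact ⟨-a, J.neg_mem ha, rfl⟩ }
    (by
      rintro b _ ⟨x, hx, rfl⟩
      obtain ⟨b, rfl⟩ := I.proj_surjective b
      exact ⟨lam b x, J.lam_mem b hx, rfl⟩)
    (by
      rintro b _ ⟨x, hx, rfl⟩
      obtain ⟨b, rfl⟩ := I.proj_surjective b
      exact ⟨b + x + -b, J.add_conj_mem b hx, rfl⟩)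
    (by
      rintro b _ ⟨x, hx, rfl⟩
      obtain ⟨b, rfl⟩ := I.proj_surjective b
      exact ⟨b * x * b⁻¹, J.mul_conj_mem b hx, rfl⟩)

/-- The preimage in `B` of an ideal of `B/I`. -/
def preimage (I : BraceIdeal B) (K : BraceIdeal I.Quotient) : BraceIdeal B :=
  ofAddSubgroup
    { carrier := {b | I.proj b ∈ K}
      zero_mem' := K.zero_mem
      add_mem' := fun ha hb => K.add_mem ha hb
      neg_mem' := fun ha => K.neg_mem ha }
    (fun b _ hx => K.lam_mem (I.proj b) hx)
    (fun b _ hx => K.add_conj_mem (I.proj b) hx)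
    (fun b _ hx => K.mul_conj_mem (I.proj b) hx)

/-- The ideal `J ∩ S` of a subbrace `S`, for an ideal `J` of `B`. -/
def restrict (J : BraceIdeal B) (S : Subbrace B) : BraceIdeal S :=
  ofAddSubgroup
    { carrier := {x | (x : B) ∈ J}
      zero_mem' := J.zero_mem
      add_mem' := fun ha hb => J.add_mem ha hb
      neg_mem' := fun ha => J.neg_mem ha }
    (fun b _ hx => J.lam_mem (b : B) hx)
    (fun b _ hx => J.add_conj_mem (b : B) hx)
    (fun b _ hx => J.mul_conj_mem (b : B) hx)

/-- The sum of a set of ideals: the subgroup of `(B,+)` generated by their union, which is an ideal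
(the zero ideal for the empty set). -/
def sum (𝒮 : Set (BraceIdeal B)) : BraceIdeal B :=
  have hlam : ∀ (b : B) {x : B}, x ∈ AddSubgroup.closure (⋃ I ∈ 𝒮, (I : Set B)) →
      lam b x ∈ AddSubgroup.closure (⋃ I ∈ 𝒮, (I : Set B)) := by
    intro b x hx
    induction hx using AddSubgroup.closure_induction with
    | mem x hx =>
      simp only [Set.mem_iUnion] at hx
      obtain ⟨I, hI, hx⟩ := hx
      exact AddSubgroup.subset_closure (Set.mem_biUnion hI (I.lam_mem b hx))
    | zero => rw [lam_zero]; exact AddSubgroup.zero_mem _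
    | add x y _ _ hx hy => rw [lam_add]; exact AddSubgroup.add_mem _ hx hy
    | neg x _ hx => rw [lam_neg]; exact AddSubgroup.neg_mem _ hx
  ofAddSubgroup (AddSubgroup.closure (⋃ I ∈ 𝒮, (I : Set B))) hlam
    (by
      intro b x hx
      induction hx using AddSubgroup.closure_induction with
      | mem x hx =>
        simp only [Set.mem_iUnion] at hx
        obtain ⟨I, hI, hx⟩ := hx
        exact AddSubgroup.subset_closure (Set.mem_biUnion hI (I.add_conj_mem b hx))
      | zero => simp
      | add x y _ _ hx hy =>
        have e : b + (x + y) + -b = (b + x + -b) + (b + y + -b) := by simp [add_assoc]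
        rw [e]; exact AddSubgroup.add_mem _ hx hy
      | neg x _ hx =>
        have e : b + -x + -b = -(b + x + -b) := by simp [add_assoc]
        rw [e]; exact AddSubgroup.neg_mem _ hx)
    (by
      intro b x hx
      suffices h : ∀ c d : B, d * lam c x * d⁻¹ ∈
          AddSubgroup.closure (⋃ I ∈ 𝒮, (I : Set B)) by
        simpa [lam_one] using h 1 b
      induction hx using AddSubgroup.closure_induction with
      | mem x hx =>
        intro c d
        simp only [Set.mem_iUnion] at hx
        obtain ⟨I, hI, hx⟩ := hx
        exact AddSubgroup.subset_closure
          (Set.mem_biUnion hI (I.mul_conj_mem d (I.lam_mem c hx)))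
      | zero => intro c d; simp [lam_zero, mul_zero', one_eq_zero]
      | add x y _ _ hx hy =>
        intro c d
        have e : d * lam c (x + y) * d⁻¹ = (d * lam c x * d⁻¹) *
            (d * lam ((lam c x)⁻¹ * c) y * d⁻¹) := by
          rw [lam_add, add_eq (lam c x), ← lam_mul]; group
        rw [e, mul_eq]
        exact AddSubgroup.add_mem _ (hx _ _) (hlam _ (hy _ _))
      | neg x _ hx =>
        intro c d
        have e : d * lam c (-x) * d⁻¹ = (d * lam ((lam c (-x))⁻¹ * c) x * d⁻¹)⁻¹ := by
          have h := inv_eq (lam c (-x))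
          rw [← lam_neg, ← lam_neg, neg_neg, ← lam_mul] at h
          rw [← h]; group
        rw [e, inv_eq]
        exact AddSubgroup.neg_mem _ (hlam _ (hx _ _)))

end BraceIdeal

namespace SkewBrace

/-- The socle `Soc(B) = Ker λ ∩ Z(B,+)`. -/
def socle (B : Type*) [SkewBrace B] : Set B :=
  {a | (∀ b : B, lam a b = b) ∧ ∀ b : B, a + b = b + a}

/-- The centre `ζ(B) = Soc(B) ∩ Z(B,·)`, an ideal of `B`. -/
def zeta (B : Type*) [SkewBrace B] : BraceIdeal B :=
  have key : ∀ {a : B}, (a ∈ socle B ∧ ∀ b : B, a * b = b * a) → ∀ b : B, lam b a = a := by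
    intro a ha b
    rw [lam, ← ha.2 b, mul_eq, ha.1.1 b, ha.1.2 b, neg_add_cancel_left]
  have lamadd : ∀ {a : B}, (a ∈ socle B ∧ ∀ b : B, a * b = b * a) → ∀ b : B, a * b = a + b := by
    intro a ha b
    rw [mul_eq, ha.1.1 b]
  BraceIdeal.ofAddSubgroup
    { carrier := {a | a ∈ socle B ∧ ∀ b : B, a * b = b * a}
      zero_mem' := by
        refine ⟨⟨fun b => ?_, fun b => ?_⟩, fun b => ?_⟩
        · rw [← one_eq_zero, lam_one]
        · simp
        · rw [zero_mul', mul_zero']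
      add_mem' := by
        intro a c ha hc
        have e : a + c = a * c := (lamadd ha c).symm
        refine ⟨⟨fun b => ?_, fun b => ?_⟩, fun b => ?_⟩
        · rw [e, lam_mul, hc.1.1, ha.1.1]
        · rw [add_assoc, hc.1.2, ← add_assoc, ha.1.2, add_assoc]
        · rw [e, mul_assoc, hc.2, ← mul_assoc, ha.2, mul_assoc]
      neg_mem' := by
        intro a ha
        have e : -a = a⁻¹ := by rw [inv_eq, key ha]
        refine ⟨⟨fun b => ?_, fun b => ?_⟩, fun b => ?_⟩
        · rw [e]
          conv_lhs => rw [← ha.1.1 b]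
          rw [← lam_mul, inv_mul_cancel, lam_one]
        · have h : AddCommute a b := ha.1.2 b
          exact h.neg_left
        · rw [e]
          have h : Commute a b := ha.2 b
          exact h.inv_left }
    (by
      intro b x hx
      rw [key hx b]
      exact hx)
    (by
      intro b x hx
      have e : b + x + -b = x := by rw [← hx.1.2 b, add_neg_cancel_right]
      rw [e]
      exact hx)
    (by
      intro b x hx
      have e : b * x * b⁻¹ = x := by rw [← hx.2 b, mul_inv_cancel_right]
      rw [e]
      exact hx)

/-- The finite terms of the upper central series: `ζ_0(B) = 0` and
`ζ_{n+1}(B)/ζ_n(B) = ζ(B/ζ_n(B))`. -/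
def zetaSeries (B : Type*) [SkewBrace B] : ℕ → BraceIdeal B
  | 0 => ⊥
  | n + 1 => (zetaSeries B n).preimage (zeta (zetaSeries B n).Quotient)

/-- `B` is centrally nilpotent if `B = ζ_m(B)` for some natural number `m`. -/
def IsCentrallyNilpotent (B : Type*) [SkewBrace B] : Prop :=
  ∃ m : ℕ, zetaSeries B m = ⊤

/-- `B` is supersoluble: there is a finite chain `0 = I_0 ≤ I_1 ≤ … ≤ I_n = B` of ideals of `B` such
that each factor `I_{i+1}/I_i` either has infinite cyclic additive group and is contained in
`Soc(B/I_i)`, or has prime order. -/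
def IsSupersoluble (B : Type*) [SkewBrace B] : Prop :=
  ∃ (n : ℕ) (I : ℕ → BraceIdeal B), I 0 = ⊥ ∧ I n = ⊤ ∧
    ∀ i < n, I i ≤ I (i + 1) ∧
      ((Infinite ((I (i + 1)).factor (I i)).toAddSubgroup ∧
          IsAddCyclic ((I (i + 1)).factor (I i)).toAddSubgroup ∧
          ((I (i + 1)).factor (I i) : Set (I i).Quotient) ⊆ socle (I i).Quotient) ∨
        (Nat.card ((I (i + 1)).factor (I i)).toAddSubgroup).Prime)

end SkewBrace

namespace BraceIdeal

variable {B : Type*} [SkewBrace B]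

/-- The ideal `I` of `B` is `B`-centrally nilpotent: there is a finite chain
`0 = J_0 ≤ J_1 ≤ … ≤ J_n = I` of ideals of `B` such that `J_{i+1}/J_i ≤ ζ(I/J_i)` for all `i < n`.
Here `I/J_i` is the quotient of the skew brace `I` by its ideal `J_i`. -/
def IsRelCentrallyNilpotent (I : BraceIdeal B) : Prop :=
  ∃ (n : ℕ) (J : ℕ → BraceIdeal B), J 0 = ⊥ ∧ J n = I ∧
    ∀ i < n, J i ≤ J (i + 1) ∧
      ((J (i + 1)).restrict I.toSubbrace).factor ((J i).restrict I.toSubbrace) ≤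
        SkewBrace.zeta ((J i).restrict I.toSubbrace).Quotient

variable (B) in
/-- The Fitting ideal of `B`: the sum of all `B`-centrally nilpotent ideals of `B`. -/
def fitting : BraceIdeal B := sum {I | I.IsRelCentrallyNilpotent}

end BraceIdeal

/-!
A factor `P` of a supersoluble series is so small that every centrally nilpotent ideal `I`
centralizes it. If `P ∩ I = 0`, this holds because all commutators of `P` and `I` lie in `P ∩ I`.
Otherwise `P` contains a nonzero element `q` of `ζ(I)`, and either `P` has prime order and is
generated by `q`, or `P` is an infinite cyclic subgroup of the socle and every `λ_x` with `x ∈ I`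
restricts to an endomorphism of `P` fixing `q`, hence to the identity. Intersecting the series
with `I` shows that `I` is `B`-centrally nilpotent. A sum of ideals centralizing a factor
centralizes it too, so the same argument applies to the Fitting ideal.
-/

theorem addMonoidHom_eq_id_of_apply_eq_self {G : Type*} [AddGroup G] [Infinite G]
    [IsAddCyclic G] (f : G →+ G) {q : G} (hq : q ≠ 0) (hfq : f q = q) : f = AddMonoidHom.id G := by
  obtain ⟨m, hm⟩ := f.map_addCyclic
  have hmul : m * intCyclicAddEquiv.symm q = intCyclicAddEquiv.symm q := by
    rw [← smul_eq_mul, ← map_zsmul, ← hm, hfq]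
  have hm_one : m = 1 := (mul_eq_right₀ (by simpa using hq)).1 hmul
  ext g
  rw [hm, hm_one, one_zsmul, AddMonoidHom.id_apply]

theorem addSubgroup_le_of_prime_card {G : Type*} [AddGroup G] {P Q : AddSubgroup G}
    (hP : (Nat.card P).Prime) {q : G} (hqP : q ∈ P) (hqQ : q ∈ Q) (hq : q ≠ 0) : P ≤ Q := by
  have : Fact (Nat.card P).Prime := ⟨hP⟩
  refine AddSubgroup.addSubgroupOf_eq_top.1
    ((Q.addSubgroupOf P).eq_bot_or_eq_top_of_prime_card.resolve_left fun h_bot => hq ?_)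
  have hmem : (⟨q, hqP⟩ : P) ∈ Q.addSubgroupOf P := hqQ
  rw [h_bot] at hmem
  exact congrArg Subtype.val (AddSubgroup.mem_bot.1 hmem)

namespace SkewBrace

variable {B C : Type*} [SkewBrace B] [SkewBrace C]

/-- The map `λ_b` as an endomorphism of `(B,+)`. -/
def lamHom (b : B) : B →+ B where
  toFun := lam b
  map_zero' := lam_zero b
  map_add' := lam_add b

theorem lam_eq_self_of_infinite_cyclic {P : AddSubgroup B} [Infinite P] [IsAddCyclic P] {q x : B}
    (hxP : ∀ y ∈ P, lam x y ∈ P) (hqP : q ∈ P) (hq : q ≠ 0) (hxq : lam x q = q) {p : B}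
    (hp : p ∈ P) : lam x p = p := by
  let lamP : P →+ P := ((lamHom x).comp P.subtype).codRestrict P fun y => hxP y y.2
  have lamP_eq_id : lamP = AddMonoidHom.id P :=
    addMonoidHom_eq_id_of_apply_eq_self lamP (q := ⟨q, hqP⟩)
      (fun h => hq (congrArg Subtype.val h)) (Subtype.ext hxq)
  exact congrArg Subtype.val (DFunLike.congr_fun lamP_eq_id ⟨p, hp⟩)

/-- The set of the additive commutator and the two `λ`-commutators of `a` and `b`. As
`a b = a + λ_a(b)`, the multiplicative commutator need not be listed: modulo an ideal, it vanishes
as soon as these three do. -/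
def commutators (a b : B) : Set B :=
  {-b + lam a b, -(b + a) + (a + b), -a + lam b a}

/-- Two elements centralize each other: they commute additively and each is fixed by the `λ`-map
of the other. They then commute multiplicatively, too. -/
structure Centralizes (a b : B) : Prop where
  lam_left : lam a b = b
  addCommute : AddCommute a b
  lam_right : lam b a = a

theorem Centralizes.symm {a b : B} (h : Centralizes a b) : Centralizes b a :=
  ⟨h.lam_right, h.addCommute.symm, h.lam_left⟩

theorem centralizes_zero_right (a : B) : Centralizes a 0 :=
  ⟨lam_zero a, AddCommute.zero_right a, by rw [← one_eq_zero, lam_one]⟩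

theorem Centralizes.add_right {a x y : B} (hx : Centralizes a x) (hy : Centralizes a y)
    (hxy : Centralizes a (lam x⁻¹ y)) : Centralizes a (x + y) where
  lam_left := by rw [lam_add, hx.lam_left, hy.lam_left]
  addCommute := hx.addCommute.add_right hy.addCommute
  lam_right := by rw [add_eq, lam_mul, hxy.lam_right, hx.lam_right]

theorem centralizes_iff {a b : B} : Centralizes a b ↔ commutators a b ⊆ {0} := by
  simp only [commutators, Set.insert_subset_iff, Set.singleton_subset_iff, Set.mem_singleton_iff,
    neg_add_eq_zero]
  exact ⟨fun ⟨h₁, h₂, h₃⟩ => ⟨h₁.symm, h₂.symm, h₃.symm⟩,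
    fun ⟨h₁, h₂, h₃⟩ => ⟨h₁.symm, h₂.symm, h₃.symm⟩⟩

theorem image_commutators (f : B →+ C) (hf : ∀ a b, f (a * b) = f a * f b) (a b : B) :
    f '' commutators a b = commutators (f a) (f b) := by
  simp only [commutators, lam, Set.image_insert_eq, Set.image_singleton, map_add, map_neg, hf]

theorem centralizes_proj_iff (A : BraceIdeal B) {a b : B} :
    Centralizes (A.proj a) (A.proj b) ↔ commutators a b ⊆ A := by
  simp only [commutators, Set.insert_subset_iff, Set.singleton_subset_iff, SetLike.mem_coe,
    ← A.proj_eq_proj]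
  exact ⟨fun ⟨h₁, h₂, h₃⟩ => ⟨h₁.symm, h₂.symm, h₃.symm⟩,
    fun ⟨h₁, h₂, h₃⟩ => ⟨h₁.symm, h₂.symm, h₃.symm⟩⟩

theorem commutators_subset_of_mem_right (A : BraceIdeal B) (a : B) {b : B} (hb : b ∈ A) :
    commutators a b ⊆ A := by
  have hb_zero : A.proj 0 = A.proj b := A.proj_eq_proj.2 (by simpa using hb)
  rw [← centralizes_proj_iff, ← hb_zero]
  exact centralizes_zero_right _

theorem commutators_subset_of_mem_left (A : BraceIdeal B) {a : B} (ha : a ∈ A) (b : B) :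
    commutators a b ⊆ A :=
  (centralizes_proj_iff A).1
    ((centralizes_proj_iff A).2 (commutators_subset_of_mem_right A b ha)).symm

theorem mem_zeta_iff {a : B} : a ∈ zeta B ↔ ∀ b, Centralizes a b := by
  constructor
  · rintro ⟨⟨hlam, hadd⟩, hmul⟩ b
    refine ⟨hlam b, hadd b, ?_⟩
    rw [lam, ← hmul b, mul_eq, hlam b, hadd b, neg_add_cancel_left]
  · intro h
    refine ⟨⟨fun b => (h b).lam_left, fun b => (h b).addCommute⟩, fun b => ?_⟩
    rw [mul_eq, mul_eq, (h b).lam_left, (h b).lam_right, (h b).addCommute.eq]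

theorem mem_zetaSeries_succ {n : ℕ} {z : B} :
    z ∈ zetaSeries B (n + 1) ↔ ∀ x, commutators z x ⊆ zetaSeries B n := by
  change (zetaSeries B n).proj z ∈ zeta _ ↔ _
  rw [mem_zeta_iff, (zetaSeries B n).proj_surjective.forall]
  exact forall_congr' fun x => centralizes_proj_iff _

theorem map_mem_zetaSeries (f : B →+ C) (hf : ∀ a b, f (a * b) = f a * f b)
    (hsurj : Function.Surjective f) {n : ℕ} {z : B} (hz : z ∈ zetaSeries B n) :
    f z ∈ zetaSeries C n := by
  induction n generalizing z with
  | zero =>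
    obtain rfl : z = 0 := hz
    rw [map_zero]
    exact BraceIdeal.zero_mem _
  | succ n ih =>
    rw [mem_zetaSeries_succ, hsurj.forall]
    intro x
    rw [← image_commutators f hf, Set.image_subset_iff]
    exact fun c hc => ih (mem_zetaSeries_succ.1 hz x hc)

theorem IsCentrallyNilpotent.of_surjective (hB : IsCentrallyNilpotent B) (f : B →+ C)
    (hf : ∀ a b, f (a * b) = f a * f b) (hsurj : Function.Surjective f) :
    IsCentrallyNilpotent C := by
  obtain ⟨n, hn⟩ := hB
  refine ⟨n, SetLike.ext fun y => ⟨fun _ => trivial, fun _ => ?_⟩⟩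
  obtain ⟨x, rfl⟩ := hsurj y
  exact map_mem_zetaSeries f hf hsurj (hn ▸ trivial)

theorem IsCentrallyNilpotent.exists_mem_zeta_ne_zero (hB : IsCentrallyNilpotent B)
    {P : BraceIdeal B} {p : B} (hpP : p ∈ P) (hp : p ≠ 0) : ∃ q ∈ P, q ∈ zeta B ∧ q ≠ 0 := by
  obtain ⟨n, hn⟩ := hB
  by_contra! h_disjoint
  have eq_zero_of_mem_zetaSeries : ∀ k, ∀ q ∈ P, q ∈ zetaSeries B k → q = 0 := by
    intro k
    induction k with
    | zero => exact fun q _ hq => hq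
    | succ k ih =>
      refine fun q hqP hq => h_disjoint q hqP (mem_zeta_iff.2 fun x => centralizes_iff.2 ?_)
      exact fun c hc => ih c (commutators_subset_of_mem_left P hqP x hc)
        (mem_zetaSeries_succ.1 hq x hc)
  exact hp (eq_zero_of_mem_zetaSeries n p hpP (hn ▸ trivial))

end SkewBrace

namespace Subbrace

variable {B : Type*} [SkewBrace B] {S : Subbrace B}

/-- The inclusion of a subbrace, as a homomorphism of additive groups. -/
def subtype (S : Subbrace B) : S →+ B where
  toFun := Subtype.val
  map_zero' := rfl
  map_add' _ _ := rfl

theorem image_coe_commutators (a b : S) :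
    Subtype.val '' commutators a b = commutators (a : B) b :=
  image_commutators S.subtype (fun _ _ => rfl) a b

theorem centralizes_of_mem_zeta {q : S} (hq : q ∈ zeta S) {x : B} (hx : x ∈ S) :
    Centralizes (q : B) x := by
  obtain ⟨h_lam, h_add, h_lam'⟩ := mem_zeta_iff.1 hq ⟨x, hx⟩
  exact ⟨congrArg Subtype.val h_lam, congrArg Subtype.val h_add, congrArg Subtype.val h_lam'⟩

theorem centralizes_of_prime_card {P : AddSubgroup B} (hP : (Nat.card P).Prime) {q : S}
    (hqP : (q : B) ∈ P) (hqS : q ∈ zeta S) (hq : (q : B) ≠ 0) {p x : B} (hp : p ∈ P)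
    (hx : x ∈ S) : Centralizes p x := by
  have hle : P ≤ (zeta S).toAddSubgroup.map S.subtype :=
    addSubgroup_le_of_prime_card hP hqP ⟨q, hqS, rfl⟩ hq
  obtain ⟨z, hz, rfl⟩ := hle hp
  exact centralizes_of_mem_zeta hz hx

end Subbrace

namespace BraceIdeal

variable {B : Type*} [SkewBrace B]

theorem isCentrallyNilpotent_factor {I : BraceIdeal B} (hI : IsCentrallyNilpotent I.toSubbrace)
    (A : BraceIdeal B) : IsCentrallyNilpotent (I.factor A).toSubbrace := by
  let projI : I.toSubbrace →+ (I.factor A).toSubbrace :=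
    { toFun := fun x => ⟨A.proj x, x, x.2, rfl⟩
      map_zero' := rfl
      map_add' := fun _ _ => rfl }
  refine hI.of_surjective projI (fun _ _ => rfl) ?_
  rintro ⟨_, x, hx, rfl⟩
  exact ⟨⟨x, hx⟩, rfl⟩

/-- The ideals allowed as factors of a series witnessing supersolubility. -/
def IsSupersolubleFactor (P : BraceIdeal B) : Prop :=
  (Infinite P.toAddSubgroup ∧ IsAddCyclic P.toAddSubgroup ∧ (P : Set B) ⊆ socle B) ∨
    (Nat.card P.toAddSubgroup).Prime

theorem IsSupersolubleFactor.centralizes {P I : BraceIdeal B} (hP : P.IsSupersolubleFactor)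
    (hI : IsCentrallyNilpotent I.toSubbrace) {p x : B} (hp : p ∈ P) (hx : x ∈ I) :
    Centralizes p x := by
  by_cases h_disjoint : ∀ c ∈ P, c ∈ I → c = 0
  · exact centralizes_iff.2 fun c hc =>
      h_disjoint c (commutators_subset_of_mem_left P hp x hc)
        (commutators_subset_of_mem_right I p hx hc)
  push Not at h_disjoint
  obtain ⟨c, hcP, hcI, hc⟩ := h_disjoint
  obtain ⟨q, hqP, hqI, hq⟩ := hI.exists_mem_zeta_ne_zero
    (P := P.restrict I.toSubbrace) (p := ⟨c, hcI⟩) hcP fun h => hc (congrArg Subtype.val h)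
  have hq_coe : (q : B) ≠ 0 := fun h => hq (Subtype.ext h)
  rcases hP with ⟨_, _, h_socle⟩ | h_prime
  · refine ⟨(h_socle hp).1 x, (h_socle hp).2 x, ?_⟩
    exact lam_eq_self_of_infinite_cyclic (P := P.toAddSubgroup) (fun _ => P.lam_mem x) hqP hq_coe
      (Subbrace.centralizes_of_mem_zeta hqI hx).lam_right hp
  · exact Subbrace.centralizes_of_prime_card h_prime hqP hqI hq_coe hp hx

/-- The ideal `I` centralizes the factor `C/A`: all commutators of elements of `C` with elements
of `I` lie in `A`. -/
def CentralizesFactor (I C A : BraceIdeal B) : Prop :=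
  ∀ p ∈ C, ∀ x ∈ I, commutators p x ⊆ A

theorem IsSupersolubleFactor.centralizesFactor {I C A : BraceIdeal B}
    (hCA : (C.factor A).IsSupersolubleFactor) (hI : IsCentrallyNilpotent I.toSubbrace) :
    I.CentralizesFactor C A := fun p hp x hx =>
  (centralizes_proj_iff A).1
    (hCA.centralizes (isCentrallyNilpotent_factor hI A) ⟨p, hp, rfl⟩ ⟨x, hx, rfl⟩)

theorem sum_induction {𝒮 : Set (BraceIdeal B)} {motive : B → Prop} (zero : motive 0)
    (add : ∀ x, ∀ I ∈ 𝒮, ∀ y ∈ I, motive x → motive (x + y)) {x : B} (hx : x ∈ sum 𝒮) :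
    motive x := by
  change x ∈ AddSubgroup.closure (⋃ I ∈ 𝒮, (I : Set B)) at hx
  induction hx using AddSubgroup.closure_induction_right with
  | zero => exact zero
  | add_right x _ y hy ih =>
    obtain ⟨I, hI, hyI⟩ := Set.mem_iUnion₂.1 hy
    exact add x I hI y hyI ih
  | add_neg_cancel x _ y hy ih =>
    obtain ⟨I, hI, hyI⟩ := Set.mem_iUnion₂.1 hy
    exact add x I hI (-y) (I.neg_mem hyI) ih

theorem CentralizesFactor.sum {C A : BraceIdeal B} {𝒮 : Set (BraceIdeal B)}
    (h : ∀ I ∈ 𝒮, I.CentralizesFactor C A) : (sum 𝒮).CentralizesFactor C A := by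
  intro p hp x hx
  rw [← centralizes_proj_iff]
  refine sum_induction (motive := fun x => Centralizes (A.proj p) (A.proj x))
    (centralizes_zero_right _) (fun x I hI y hy hx => ?_) hx
  have h_proj : ∀ z ∈ I, Centralizes (A.proj p) (A.proj z) := fun z hz =>
    (centralizes_proj_iff A).2 (h I hI p hp z hz)
  exact hx.add_right (h_proj y hy) (h_proj _ (I.lam_mem x⁻¹ hy))

/-- The intersection of two ideals. -/
instance : Min (BraceIdeal B) := ⟨fun I J => ofAddSubgroup (I.toAddSubgroup ⊓ J.toAddSubgroup)
  (fun b _ hx => ⟨I.lam_mem b hx.1, J.lam_mem b hx.2⟩)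
  (fun b _ hx => ⟨I.add_conj_mem b hx.1, J.add_conj_mem b hx.2⟩)
  (fun b _ hx => ⟨I.mul_conj_mem b hx.1, J.mul_conj_mem b hx.2⟩)⟩

theorem bot_inf (I : BraceIdeal B) : ⊥ ⊓ I = ⊥ :=
  SetLike.ext fun _ => ⟨And.left, fun hx => ⟨hx, (show _ = (0 : B) from hx) ▸ I.zero_mem⟩⟩

theorem top_inf (I : BraceIdeal B) : ⊤ ⊓ I = I :=
  SetLike.ext fun _ => ⟨And.right, fun hx => ⟨trivial, hx⟩⟩

theorem CentralizesFactor.inf {I C A : BraceIdeal B} (h : I.CentralizesFactor C A) :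
    I.CentralizesFactor (C ⊓ I) (A ⊓ I) := fun p hp x hx =>
  Set.subset_inter (h p hp.1 x hx) (commutators_subset_of_mem_left I hp.2 x)

theorem coe_restrict (J : BraceIdeal B) (S : Subbrace B) :
    (J.restrict S : Set S) = Subtype.val ⁻¹' (J : Set B) := rfl

theorem factor_restrict_le_zeta_iff {I J K : BraceIdeal B} :
    (K.restrict I.toSubbrace).factor (J.restrict I.toSubbrace) ≤
        zeta (J.restrict I.toSubbrace).Quotient ↔ I.CentralizesFactor (K ⊓ I) J := by
  have mem_zeta_proj_iff (z : I.toSubbrace) :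
      (J.restrict I.toSubbrace).proj z ∈ zeta (J.restrict I.toSubbrace).Quotient ↔
        ∀ x ∈ I, commutators (z : B) x ⊆ J := by
    rw [mem_zeta_iff, (J.restrict I.toSubbrace).proj_surjective.forall, Subtype.forall]
    refine forall₂_congr fun x hx => ?_
    rw [centralizes_proj_iff, coe_restrict, ← Subbrace.image_coe_commutators z ⟨x, hx⟩,
      Set.image_subset_iff]
  constructor
  · exact fun h z hz => (mem_zeta_proj_iff ⟨z, hz.2⟩).1 (h ⟨⟨z, hz.2⟩, hz.1, rfl⟩)
  · rintro h _ ⟨z, hz, rfl⟩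
    exact (mem_zeta_proj_iff z).2 (h z ⟨hz, z.2⟩)

theorem isRelCentrallyNilpotent_of_centralizesFactor {I : BraceIdeal B} {n : ℕ}
    {C : ℕ → BraceIdeal B} (hC_zero : C 0 = ⊥) (hC_top : C n = ⊤)
    (hC_mono : ∀ i < n, C i ≤ C (i + 1)) (hI : ∀ i < n, I.CentralizesFactor (C (i + 1)) (C i)) :
    I.IsRelCentrallyNilpotent := by
  refine ⟨n, fun i => C i ⊓ I, ?_, ?_, fun i hi => ⟨?_, factor_restrict_le_zeta_iff.2 ?_⟩⟩
  · simp only [hC_zero, bot_inf]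
  · simp only [hC_top, top_inf]
  · exact fun x hx => ⟨hC_mono i hi hx.1, hx.2⟩
  · exact fun p hp => (hI i hi).inf p hp.1

theorem IsRelCentrallyNilpotent.isCentrallyNilpotent {I : BraceIdeal B}
    (h : I.IsRelCentrallyNilpotent) : IsCentrallyNilpotent I.toSubbrace := by
  obtain ⟨n, J, hJ_zero, hJ_top, hJ⟩ := h
  have mem_zetaSeries : ∀ i ≤ n, ∀ z : I.toSubbrace, (z : B) ∈ J i →
      z ∈ zetaSeries I.toSubbrace i := by
    intro i
    induction i with
    | zero =>
      intro _ z hz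
      rw [hJ_zero] at hz
      exact Subtype.ext hz
    | succ i ih =>
      intro hi z hz
      refine mem_zetaSeries_succ.2 fun x c hc => ih (Nat.le_of_succ_le hi) c ?_
      refine factor_restrict_le_zeta_iff.1 (hJ i hi).2 z ⟨hz, z.2⟩ x x.2 ?_
      exact Subbrace.image_coe_commutators z x ▸ Set.mem_image_of_mem _ hc
  exact ⟨n, SetLike.ext fun z =>
    ⟨fun _ => trivial, fun _ => mem_zetaSeries n le_rfl z (hJ_top ▸ z.2)⟩⟩

end BraceIdeal

theorem theorem3p32 {B : Type*} [SkewBrace B] (hB : SkewBrace.IsSupersoluble B) :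
    (∀ I : BraceIdeal B, SkewBrace.IsCentrallyNilpotent I.toSubbrace →
      I.IsRelCentrallyNilpotent) ∧
    SkewBrace.IsCentrallyNilpotent (BraceIdeal.fitting B).toSubbrace ∧
    BraceIdeal.fitting B =
      BraceIdeal.sum {I : BraceIdeal B | SkewBrace.IsCentrallyNilpotent I.toSubbrace} := by
  obtain ⟨n, C, hC_zero, hC_top, hC⟩ := hB
  have centralizes_factors : ∀ I : BraceIdeal B, IsCentrallyNilpotent I.toSubbrace →
      ∀ i < n, I.CentralizesFactor (C (i + 1)) (C i) := fun I hI i hi =>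
    BraceIdeal.IsSupersolubleFactor.centralizesFactor (hC i hi).2 hI
  have isRel_of_centralizes : ∀ I : BraceIdeal B,
      (∀ i < n, I.CentralizesFactor (C (i + 1)) (C i)) → I.IsRelCentrallyNilpotent := fun _ =>
    BraceIdeal.isRelCentrallyNilpotent_of_centralizesFactor hC_zero hC_top fun i hi => (hC i hi).1
  have isRel_iff : ∀ I : BraceIdeal B,
      I.IsRelCentrallyNilpotent ↔ IsCentrallyNilpotent I.toSubbrace := fun I =>
    ⟨fun h => h.isCentrallyNilpotent, fun h => isRel_of_centralizes I (centralizes_factors I h)⟩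
  have fitting_isRel : (BraceIdeal.fitting B).IsRelCentrallyNilpotent :=
    isRel_of_centralizes _ fun i hi =>
      BraceIdeal.CentralizesFactor.sum fun I hI => centralizes_factors I ((isRel_iff I).1 hI) i hi
  exact ⟨fun I => (isRel_iff I).2, fitting_isRel.isCentrallyNilpotent,
    congrArg BraceIdeal.sum (Set.ext isRel_iff)⟩
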